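/- **Definitions.** For infinite cardinals $\kappa,\theta$, an ultrafilter $D$ over a set $I$ is *$(\kappa,\theta)$-regular* if there is a function $f$ from $I$ to the set of subsets of $\theta$ of cardinality $<\kappa$ such that $\{i\in I : a\in f(i)\}\in D$ for every $a\in\theta$ (equivalently: there is a family of $\theta$ members of $D$ such that the intersection of any $\kappa$ members of the family is empty). If $\nu=\omega_\beta$, then $\nu^{+\gamma}$ denotes $\omega_{\beta+\gamma}$. A cardinal is *weakly inaccessible* if it is an uncountable regular limit cardinal. For cardinals $\mu$ of cofinality $\omega$ and ordinals $\alpha>0$, the relation "$\mu$ has order $\ge\alpha$" is defined by recursion on $\alpha$: every $\mu$ of cofinality $\omega$ has order $\ge 1$; for $\alpha>1$, $\mu$ has order $\ge\alpha$ if and only if for every $\beta$ with $0<\beta<\alpha$, $\mu$ is the limit of a strictly increasing sequence $(\mu_n)_{n<\omega}$ of cardinals, each of cofinality $\omega$ and of order $\ge\beta$. **Proposition 8.2.** Suppose that $\lambda$ and $\mu$ are infinite cardinals and $\alpha,\gamma$ are ordinals such that (a) $\alpha>0$, and $\alpha\le$ the first weakly inaccessible cardinal (or there is no weakly inaccessible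 cardinal); (b) $\mu$ has cofinality $\omega$ and order $\ge\alpha$; (c) $\lambda<\mu$, and $\lambda=\nu^{+\gamma}$ for some regular (infinite) cardinal $\nu$, where $\gamma<\omega^\alpha$ (ordinal exponentiation). If $D$ is a $(\lambda^+,\mu)$-regular ultrafilter, then $D$ is $(\lambda,\mu)$-regular. Moreover, $D$ is either $(\omega,\omega)$-regular or $(\nu,\mu)$-regular. -/

import Mathlib

open Cardinal Ordinal

universe u

/-- `IsRegularUltrafilter D κ θ`: the ultrafilter `D` over `I` is `(κ, θ)`-regular, that is, there
is a function `f` from `I` to the subsets of cardinality `< κ` of a set of cardinality `θ` such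
that, for every element `a` of this set, `{i | a ∈ f i}` belongs to `D`. -/
def IsRegularUltrafilter {I : Type u} (D : Ultrafilter I) (κ θ : Cardinal.{u}) : Prop :=
  ∃ f : I → Set θ.out, (∀ i, #(f i) < κ) ∧ ∀ a : θ.out, {i | a ∈ f i} ∈ D

/-- The iterated successor `ν^{+γ}`. As `preAleph` enumerates all cardinals in increasing order,
this is the `γ`-th cardinal after `ν`; for `ν = ℵ_β` it is `ℵ_(β + γ)`. -/
noncomputable def iterSucc (ν : Cardinal.{u}) (γ : Ordinal.{u}) : Cardinal.{u} :=
  preAleph (preAleph.symm ν + γ)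

theorem iterSucc_aleph (β γ : Ordinal.{u}) : iterSucc (ℵ_ β) γ = ℵ_ (β + γ) := by
  rw [iterSucc, preAleph_symm_aleph, aleph_eq_preAleph, add_assoc]

/-- `κ` is weakly inaccessible: an uncountable regular limit cardinal. -/
structure IsWeaklyInaccessible (κ : Cardinal.{u}) : Prop where
  aleph0_lt : ℵ₀ < κ
  isRegular : κ.IsRegular
  isSuccLimit : Order.IsSuccLimit κ

/-- `OrderGE α μ`, for an ordinal `α ≠ 0`: the cardinal `μ` has cofinality `ω` and its order
is `≥ α`. For `α = 1` only the condition on the cofinality is left; for `α > 1`, for every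
`β < α` (`β ≠ 0`), `μ` is the limit of a strictly increasing sequence of cardinals, each of
cofinality `ω` and of order `≥ β`. -/
def OrderGE (α : Ordinal.{u}) (μ : Cardinal.{u}) : Prop :=
  μ.ord.cof = ℵ₀ ∧
    ∀ β : Ordinal.{u}, 0 < β → β < α →
      ∃ s : ℕ → Cardinal.{u}, StrictMono s ∧ IsLUB (Set.range s) μ ∧ ∀ n, OrderGE β (s n)
termination_by α

/-- The defining equation of `OrderGE`. -/
theorem orderGE_iff (α : Ordinal.{u}) (μ : Cardinal.{u}) :
    OrderGE α μ ↔ μ.ord.cof = ℵ₀ ∧ ∀ β : Ordinal.{u}, 0 < β → β < α →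
      ∃ s : ℕ → Cardinal.{u}, StrictMono s ∧ IsLUB (Set.range s) μ ∧ ∀ n, OrderGE β (s n) := by
  rw [OrderGE]

theorem orderGE_one (μ : Cardinal.{u}) : OrderGE 1 μ ↔ μ.ord.cof = ℵ₀ := by
  rw [orderGE_iff]
  exact and_iff_left fun β h0 h1 => absurd (Order.lt_one_iff.1 h1) h0.ne'

/-! ### Lowering and gluing regularity -/

namespace IsRegularUltrafilter

variable {I : Type u} {D : Ultrafilter I} {κ κ' θ θ' μ : Cardinal.{u}}

/-! Write `λ = ν^{+γ}`. By `of_succ`, `D` is `(λ, θ)`-regular for all `θ < μ`; the issue is to glue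
these into regularity at `μ`, a sum of countably many smaller cardinals. If `D` is `(ω, ω)`-regular,
only finitely many pieces are used at each index, so gluing works even for singular `λ`. Otherwise
functions into sets smaller than every weakly inaccessible are constant modulo `D`. So a family of
sets of size `< ν^{+γ}`, `γ` limit, almost everywhere has sizes `≤ ν^{+δ}` for one `δ < γ`. Writing
`γ = ε + ω^η`, induction on `γ` descends to `ν` (`of_succ_iterSucc`), gluing only at regular
cardinals. -/

theorem of_eventually {A : Type u} (f : I → Set A) (hκ : 0 < κ)
    (hf : ∀ᶠ i in D, #(f i) < κ) (hA : ∀ a, ∀ᶠ i in D, a ∈ f i) (hθ : θ ≤ #A) :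
    IsRegularUltrafilter D κ θ := by
  classical
  rw [← mk_out θ, le_def] at hθ
  obtain ⟨e⟩ := hθ
  refine ⟨fun i => if #(f i) < κ then e ⁻¹' f i else ∅, fun i => ?_, fun a => ?_⟩
  · dsimp only
    split_ifs with h
    · exact (mk_preimage_of_injective _ _ e.injective).trans_lt h
    · simpa using hκ
  · filter_upwards [hf, hA (e a)] with i hi ha
    simpa [hi] using ha

theorem pos (h : IsRegularUltrafilter D κ θ) : 0 < κ := by
  obtain ⟨f, hf, -⟩ := h
  obtain ⟨i⟩ := D.neBot.nonempty
  exact zero_le.trans_lt (hf i)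

theorem mono (h : IsRegularUltrafilter D κ θ) (hκ : κ ≤ κ') (hθ : θ' ≤ θ) :
    IsRegularUltrafilter D κ' θ' := by
  have hpos := h.pos
  obtain ⟨f, hf, hA⟩ := h
  exact of_eventually f (hpos.trans_le hκ) (.of_forall fun i => (hf i).trans_le hκ) hA (by simpa)

/-- Comparing, modulo `D`, the positions of the elements of `θ⁺` in enumerations of the sets `f i`
of length `κ`, some element has `θ` many predecessors. -/
theorem of_succ (hθ : ℵ₀ ≤ θ)
    (h : IsRegularUltrafilter D (Order.succ κ) (Order.succ θ)) : IsRegularUltrafilter D κ θ := by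
  classical
  obtain ⟨A, hAcard, f, hf, hA⟩ : ∃ A : Type u, #A = Order.succ θ ∧
      ∃ f : I → Set A, (∀ i, #(f i) < Order.succ κ) ∧ ∀ a, ∀ᶠ i in D, a ∈ f i :=
    ⟨_, mk_out _, h⟩
  have hemb : ∀ i, ∃ g : f i → κ.ord.ToType, Function.Injective g := fun i => by
    have : #(f i) ≤ #κ.ord.ToType := by simpa using Order.lt_succ_iff.1 (hf i)
    obtain ⟨g⟩ := this
    exact ⟨g, g.injective⟩
  choose g hg using hemb
  let lt : A → A → I → Prop := fun a b i => ∃ (ha : a ∈ f i) (hb : b ∈ f i), g i ⟨a, ha⟩ < g i ⟨b, hb⟩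
  let P : A → Set A := fun b => {a | ∀ᶠ i in D, lt a b i}
  have htot : ∀ a b, a ≠ b → a ∈ P b ∨ b ∈ P a := fun a b hab => by
    refine Ultrafilter.eventually_or.1 ?_
    filter_upwards [hA a, hA b] with i ha hb
    have hne : g i ⟨a, ha⟩ ≠ g i ⟨b, hb⟩ := fun h => hab (by simpa using hg i h)
    exact hne.lt_or_gt.imp (fun h => ⟨ha, hb, h⟩) fun h => ⟨hb, ha, h⟩
  -- Otherwise some `b` lies outside `T` and every `P a` with `a ∈ T`, so by totality `P b` contains
  -- `T`, of size `θ`.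
  have hP : ∃ b, θ ≤ #(P b) := by
    by_contra! hlt
    obtain ⟨T, hT⟩ : ∃ T : Set A, #T = θ :=
      le_mk_iff_exists_set.1 (hAcard ▸ Order.le_succ θ)
    have hU : #(T ∪ ⋃ a ∈ T, P a : Set A) < #A := by
      have : #(⋃ a ∈ T, P a) ≤ θ := by
        refine (mk_biUnion_le _ _).trans ((mul_le_mul' hT.le (ciSup_le' fun a => ?_)).trans
          (mul_eq_self hθ).le)
        exact (hlt a).le
      refine (mk_union_le _ _).trans_lt ?_
      rw [hT, hAcard, Order.lt_succ_iff]
      exact add_le_of_le hθ le_rfl this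
    obtain ⟨b, hb⟩ : ∃ b, b ∉ (T ∪ ⋃ a ∈ T, P a : Set A) := by
      by_contra! hall
      rw [Set.eq_univ_of_forall hall, mk_univ] at hU
      exact hU.false
    simp only [Set.mem_union, Set.mem_iUnion, not_or, not_exists] at hb
    refine (hlt b).not_ge (hT.ge.trans (mk_le_mk_of_subset fun a ha => ?_))
    exact (htot a b fun h => hb.1 (h ▸ ha)).resolve_right (hb.2 a ha)
  obtain ⟨b, hb⟩ := hP
  have hsize : ∀ i, b ∈ f i → #{a : P b | lt a b i} < κ := fun i hbi => by
    have := mk_Iio_lt (g i ⟨b, hbi⟩) (by simp)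
    rw [mk_ord_toType] at this
    refine lt_of_le_of_lt ?_ this
    refine mk_le_of_injective (f := fun x => ⟨g i ⟨x.1.1, x.2.1⟩, x.2.2.2⟩) fun x y hxy => ?_
    have := hg i (Subtype.ext_iff.1 hxy)
    simpa [Subtype.ext_iff] using this
  obtain ⟨i, hi⟩ := (hA b).exists
  exact of_eventually (fun i => {a : P b | lt a b i}) (zero_le.trans_lt (hsize i hi))
    (Filter.Eventually.mono (hA b) hsize) (fun a => a.2) hb

/-- If a set of size `< cf κ` is attached to `D`-almost every index so that every element of `ι` is
eventually in it, then the `(κ, t n)`-regularity of `D` for all `n : ι` adds up. -/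
theorem of_sum {ι : Type u} {t : ι → Cardinal.{u}} (hκ : ℵ₀ ≤ κ) (h : I → Set ι)
    (hh : ∀ i, #(h i) < κ.ord.cof) (hmem : ∀ n, ∀ᶠ i in D, n ∈ h i)
    (ht : ∀ n, IsRegularUltrafilter D κ (t n)) (hμ : μ ≤ Cardinal.sum t) :
    IsRegularUltrafilter D κ μ := by
  choose f hf hA using ht
  let F : I → Set (Σ n, (t n).out) := fun i => ⋃ n ∈ h i, Sigma.mk n '' f n i
  refine of_eventually F (aleph0_pos.trans_le hκ) (.of_forall fun i => ?_) ?_ (by simpa using hμ)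
  · refine (mk_biUnion_le _ _).trans_lt (mul_lt_of_lt hκ ((hh i).trans_le (cof_ord_le _)) ?_)
    exact iSup_lt_of_lt_cof_ord (hh i) fun n => mk_image_le.trans_lt (hf n i)
  · rintro ⟨n, a⟩
    filter_upwards [hmem n, hA n a] with i hi ha
    exact Set.mem_biUnion hi ⟨a, ha, rfl⟩

end IsRegularUltrafilter

theorem exists_le_sum_of_lt {μ : Cardinal.{u}} (hμ : ℵ₀ ≤ μ) :
    ∃ (ι : Type u) (t : ι → Cardinal.{u}), #ι = μ.ord.cof ∧ (∀ n, t n < μ) ∧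
      μ ≤ Cardinal.sum t := by
  obtain ⟨s, hs, hcard⟩ := Order.exists_cof_eq μ.ord.ToType
  have := Cardinal.noMaxOrder hμ
  refine ⟨s, fun a => #(Set.Iio a.1), by rw [hcard, cof_toType], fun a => ?_, ?_⟩
  · simpa using mk_Iio_lt a.1 (by simp)
  · conv_lhs => rw [← mk_ord_toType μ, ← mk_univ]
    rw [← Set.eq_univ_of_forall (s := ⋃ a : s, Set.Iio a.1)]
    · exact mk_iUnion_le_sum_mk
    · intro x
      obtain ⟨y, hxy⟩ := exists_gt x
      obtain ⟨a, ha, hya⟩ := hs y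
      exact Set.mem_iUnion.2 ⟨⟨a, ha⟩, hxy.trans_le hya⟩

namespace IsRegularUltrafilter

variable {I : Type u} {D : Ultrafilter I} {κ κ' θ θ' μ : Cardinal.{u}}

theorem of_forall_lt_of_cof_lt (hκ : ℵ₀ ≤ κ) (hμ : ℵ₀ ≤ μ) (hcof : μ.ord.cof < κ.ord.cof)
    (h : ∀ θ < μ, IsRegularUltrafilter D κ θ) : IsRegularUltrafilter D κ μ := by
  obtain ⟨ι, t, hι, ht, hsum⟩ := exists_le_sum_of_lt hμ
  exact of_sum hκ (fun _ => Set.univ) (fun _ => by simpa [hι]) (by simp) (fun n => h _ (ht n)) hsum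

theorem of_forall_lt_of_aleph0 (hD : IsRegularUltrafilter D ℵ₀ ℵ₀) (hκ : ℵ₀ ≤ κ)
    (hcof : μ.ord.cof = ℵ₀) (h : ∀ θ < μ, IsRegularUltrafilter D κ θ) :
    IsRegularUltrafilter D κ μ := by
  have hμ : ℵ₀ ≤ μ := hcof.ge.trans (cof_ord_le μ)
  obtain ⟨ι, t, hι, ht, hsum⟩ := exists_le_sum_of_lt hμ
  obtain ⟨f, hf, hA⟩ := hD
  obtain ⟨e⟩ := Cardinal.eq.1 ((hι.trans hcof).trans (mk_out ℵ₀).symm)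
  refine of_sum hκ (fun i => e ⁻¹' f i) (fun i => ?_) (fun n => hA (e n))
    (fun n => h _ (ht n)) hsum
  exact (mk_preimage_of_injective _ _ e.injective).trans_lt
    ((hf i).trans_le (aleph0_le_cof_iff.2 (one_lt_cof_iff.2 (isSuccLimit_ord hκ))))

end IsRegularUltrafilter

/-! ### Functions constant modulo `D` -/

/-- Every function from `I` to a set of size `c` is constant modulo `D`. -/
def IsConstantOn {I : Type u} (D : Ultrafilter I) (c : Cardinal.{u}) : Prop :=
  ∀ (T : Type u), #T ≤ c → ∀ k : I → T, ∃ t, ∀ᶠ i in D, k i = t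

theorem Ultrafilter.exists_eventually_eq_of_bounded {I : Type u} {D : Ultrafilter I}
    {c : Cardinal.{u}} (hc : ℵ₀ ≤ c) (IH : ∀ d < c, IsConstantOn D d) (k : I → c.ord.ToType)
    {a : c.ord.ToType} (ha : ∀ᶠ i in D, k i ≤ a) : ∃ t, ∀ᶠ i in D, k i = t := by
  classical
  have := Cardinal.noMaxOrder hc
  obtain ⟨b, hab⟩ := exists_gt a
  have hlt : #(Set.Iio b) < c := by simpa using mk_Iio_lt b (by simp)
  obtain ⟨t, ht⟩ := IH _ hlt (Set.Iio b) le_rfl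
    fun i => if h : k i ≤ a then ⟨k i, h.trans_lt hab⟩ else ⟨a, hab⟩
  refine ⟨t, ?_⟩
  filter_upwards [ha, ht] with i hi h
  simpa [hi, Subtype.ext_iff] using h

/-- Suppose `k` is unbounded modulo `D` in the least bad `c`. For `c = ω`, the sets `Iio (k i)`
witness `(ω, ω)`-regularity. For `c = d⁺`, injections of `Iio (k i)` into `d` stabilise modulo `D`
to an injection of `d⁺` into `d`. For singular `c`, a bound of `k i` in a short cofinal set is
constant modulo `D`. -/
theorem isConstantOn_of_lt_weaklyInaccessible {I : Type u} {D : Ultrafilter I}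
    (hD : ¬ IsRegularUltrafilter D ℵ₀ ℵ₀) (c : Cardinal.{u})
    (hc : ∀ χ : Cardinal.{u}, IsWeaklyInaccessible χ → c < χ) : IsConstantOn D c := by
  induction c using WellFoundedLT.induction with
  | ind c IH =>
  replace IH : ∀ d < c, IsConstantOn D d := fun d hd =>
    IH d hd fun χ hχ => hd.trans (hc χ hχ)
  intro T hT
  rcases hT.lt_or_eq with hT | hT
  · exact IH _ hT T le_rfl
  rcases lt_or_ge c ℵ₀ with hfin | hinf
  · intro k
    have : Finite T := lt_aleph0_iff_finite.1 (hT.trans_lt hfin)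
    exact Ultrafilter.eventually_exists_iff.1 (.of_forall fun i => ⟨k i, rfl⟩)
  obtain ⟨e⟩ := Cardinal.eq.1 (hT.trans (mk_ord_toType c).symm)
  suffices h : ∀ k : I → c.ord.ToType, ∃ t, ∀ᶠ i in D, k i = t by
    intro k
    obtain ⟨t, ht⟩ := h (e ∘ k)
    exact ⟨e.symm t, ht.mono fun i hi => by simp [← hi]⟩
  clear! T
  intro k
  by_cases hb : ∃ a, ∀ᶠ i in D, k i ≤ a
  · exact Ultrafilter.exists_eventually_eq_of_bounded hinf IH k hb.choose_spec
  have hub : ∀ a, ∀ᶠ i in D, a < k i := fun a => by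
    rw [not_exists] at hb
    simpa using Ultrafilter.eventually_not.2 (hb a)
  exfalso
  rcases isRegular_or_isSingular hinf with hreg | hsing
  · rcases hinf.eq_or_lt with rfl | hinf'
    · refine hD (.of_eventually (fun i => Set.Iio (k i)) aleph0_pos (.of_forall fun i => ?_) hub
        (by simp))
      simpa using mk_Iio_lt (k i) (by simp)
    by_cases hlim : Order.IsSuccLimit c
    · exact (hc c ⟨hinf', hreg, hlim⟩).false
    obtain ⟨d, rfl⟩ : ∃ d, Order.succ d = c := by
      rw [Cardinal.isSuccLimit_iff, Order.isSuccPrelimit_iff_succ_ne] at hlim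
      simpa [hreg.ne_zero] using hlim
    have hemb : ∀ b : (Order.succ d).ord.ToType, ∃ g : Set.Iio b → d.out, Function.Injective g :=
      fun b => by
        have : #(Set.Iio b) ≤ #d.out := by
          simpa [Order.lt_succ_iff] using mk_Iio_lt b (by simp)
        exact ⟨this.some, this.some.injective⟩
    choose g hg using hemb
    have hd : Nonempty d.out := by
      rw [← mk_ne_zero_iff, mk_out]
      rintro rfl
      exact hinf'.not_ge (by simp)
    have hφ : ∀ a, ∃ t : d.out, ∀ᶠ i in D, ∃ h : a < k i, g (k i) ⟨a, h⟩ = t := fun a => by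
      classical
      obtain ⟨t, ht⟩ := IH d (Order.lt_succ d) d.out (by simp) fun i =>
        if h : a < k i then g (k i) ⟨a, h⟩ else Classical.arbitrary _
      refine ⟨t, ?_⟩
      filter_upwards [hub a, ht] with i hi h
      exact ⟨hi, by simpa [hi] using h⟩
    choose φ hφ using hφ
    have hinj : Function.Injective φ := fun a b hab => by
      obtain ⟨i, ⟨ha, ha'⟩, hb, hb'⟩ := ((hφ a).and (hφ b)).exists
      exact Subtype.ext_iff.1 (hg _ (ha'.trans (hab.trans hb'.symm)))
    have := mk_le_of_injective hinj
    simp at this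
  · obtain ⟨s, hs, hcard⟩ := Order.exists_cof_eq c.ord.ToType
    rw [cof_toType] at hcard
    choose e he hke using fun i => hs (k i)
    obtain ⟨t, ht⟩ := IH #s (hcard ▸ hsing.cof_ord_lt) s le_rfl fun i => ⟨e i, he i⟩
    obtain ⟨i, hi, hti⟩ := ((hub t).and ht).exists
    exact hi.not_ge ((hke i).trans (by simp [← hti]))

theorem IsConstantOn.mono {I : Type u} {D : Ultrafilter I} {c d : Cardinal.{u}}
    (h : IsConstantOn D d) (hcd : c ≤ d) : IsConstantOn D c :=
  fun T hT => h T (hT.trans hcd)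

/-! ### Iterated successors and ordinal arithmetic -/

theorem iterSucc_zero (ν : Cardinal.{u}) : iterSucc ν 0 = ν := by
  simp [iterSucc]

theorem iterSucc_add (ν : Cardinal.{u}) (a b : Ordinal.{u}) :
    iterSucc ν (a + b) = iterSucc (iterSucc ν a) b := by
  simp [iterSucc, add_assoc]

theorem iterSucc_add_one (ν : Cardinal.{u}) (a : Ordinal.{u}) :
    iterSucc ν (a + 1) = Order.succ (iterSucc ν a) := by
  rw [iterSucc, iterSucc, succ_preAleph, add_assoc]

theorem iterSucc_strictMono (ν : Cardinal.{u}) : StrictMono (iterSucc ν) := fun a b h => by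
  simpa [iterSucc] using h

theorem le_iterSucc (ν : Cardinal.{u}) (a : Ordinal.{u}) : ν ≤ iterSucc ν a := by
  conv_lhs => rw [← iterSucc_zero ν]
  exact (iterSucc_strictMono ν).monotone zero_le

theorem exists_le_iterSucc_of_lt {ν c : Cardinal.{u}} {γ : Ordinal.{u}} (hγ : γ ≠ 0)
    (h : c < iterSucc ν γ) : ∃ δ < γ, c ≤ iterSucc ν δ := by
  rw [iterSucc, ← OrderIso.symm_apply_lt, Ordinal.lt_add_iff hγ] at h
  obtain ⟨δ, hδ, h⟩ := h
  exact ⟨δ, hδ, by rwa [iterSucc, ← OrderIso.symm_apply_le]⟩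

/-- The least nonzero tail of `γ` is additively indecomposable. -/
theorem Ordinal.exists_eq_add_omega0_opow {γ : Ordinal.{u}} (hγ : γ ≠ 0) :
    ∃ ε η : Ordinal.{u}, ε < γ ∧ ε + ω ^ η = γ := by
  let S : Set Ordinal.{u} := {τ | ∃ ε < γ, ε + τ = γ}
  have hS : S.Nonempty := ⟨γ, 0, pos_iff_ne_zero.2 hγ, zero_add γ⟩
  obtain ⟨ε, hε, hadd⟩ := csInf_mem hS
  have hprin : IsPrincipal (· + ·) (sInf S) := fun a b ha hb => by
    have hmem : sInf S - a ∈ S :=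
      ⟨ε + a, by conv_rhs => rw [← hadd]
                 gcongr,
        by rw [add_assoc, Ordinal.add_sub_cancel_of_le ha.le, hadd]⟩
    exact lt_sub.1 (hb.trans_le (csInf_le' hmem))
  rcases isPrincipal_add_iff_zero_or_omega0_opow.1 hprin with h0 | ⟨η, hη⟩
  · rw [h0, add_zero] at hadd
    exact absurd hadd hε.ne
  · exact ⟨ε, η, hε, by rw [← hadd, ← hη]⟩

theorem card_lt_of_lt_omega0_opow {χ : Cardinal.{u}} {α γ : Ordinal.{u}} (hχ : ℵ₀ < χ)
    (hα : α ≤ χ.ord) (hγ : γ < ω ^ α) : γ.card < χ := by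
  rw [← lt_ord]
  have hω : ω < χ.ord := omega0_lt_ord.2 hχ
  rcases hα.lt_or_eq with hα | rfl
  · exact hγ.trans (isPrincipal_opow_ord hχ.le hω hα)
  · obtain ⟨β, hβ, h⟩ :=
      (lt_opow_of_isSuccLimit omega0_ne_zero (isSuccLimit_ord hχ.le)).1 hγ
    exact h.trans (isPrincipal_opow_ord hχ.le hω hβ)

/-! ### The descent from `ν^{+γ}` to `ν` -/

namespace IsRegularUltrafilter

variable {I : Type u} {D : Ultrafilter I} {κ μ : Cardinal.{u}}

theorem of_succ_of_lt {θ : Cardinal.{u}} (hμ : ℵ₀ < μ)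
    (h : IsRegularUltrafilter D (Order.succ κ) μ) (hθ : θ < μ) : IsRegularUltrafilter D κ θ :=
  (of_succ (le_max_right θ ℵ₀)
    (h.mono le_rfl (Order.succ_le_of_lt (max_lt hθ hμ)))).mono le_rfl (le_max_left _ _)

theorem of_forall_lt_of_isRegular (hD : ¬ IsRegularUltrafilter D ℵ₀ ℵ₀) (hμ : ℵ₀ < μ)
    (hcof : μ.ord.cof = ℵ₀) (hκ : κ.IsRegular) (h : ∀ θ < μ, IsRegularUltrafilter D κ θ) :
    IsRegularUltrafilter D κ μ := by
  rcases hκ.aleph0_le.eq_or_lt with rfl | hκ'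
  · exact absurd (h _ hμ) hD
  · exact of_forall_lt_of_cof_lt hκ'.le hμ.le (by rwa [hcof, hκ.cof_ord]) h

theorem of_succ_iterSucc (hD : ¬ IsRegularUltrafilter D ℵ₀ ℵ₀) (γ : Ordinal.{u})
    (hγ : IsConstantOn D γ.card) {ν : Cardinal.{u}} {α : Ordinal.{u}} (hν : ν.IsRegular)
    (hγα : γ < ω ^ α) (hμ : OrderGE α μ) (hlt : iterSucc ν γ < μ)
    (h : IsRegularUltrafilter D (Order.succ (iterSucc ν γ)) μ) : IsRegularUltrafilter D ν μ := by
  induction γ using WellFoundedLT.induction generalizing ν α μ with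
  | ind γ IH =>
  have hμ' := (orderGE_iff α μ).1 hμ
  have hν' : ∀ δ, ℵ₀ ≤ iterSucc ν δ := fun δ => hν.aleph0_le.trans (le_iterSucc ν δ)
  have hμ0 : ℵ₀ < μ := (hν' γ).trans_lt hlt
  have hlow : ∀ θ < μ, IsRegularUltrafilter D (iterSucc ν γ) θ := fun θ hθ =>
    of_succ_of_lt hμ0 h hθ
  -- The `+ 1` gives a regular cardinal, where gluing works, and the successor form needed for
  -- induction at `ε`.
  have hstep : ∀ ε < γ, (∀ θ < μ, IsRegularUltrafilter D (iterSucc ν (ε + 1)) θ) →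
      IsRegularUltrafilter D ν μ := fun ε hε hθ => by
    rw [iterSucc_add_one] at hθ
    exact IH ε hε (hγ.mono (card_le_card hε.le)) hν (hε.trans hγα) hμ
      ((iterSucc_strictMono ν hε).trans hlt)
      (of_forall_lt_of_isRegular hD hμ0 hμ'.1 (isRegular_succ (hν' ε)) hθ)
  rcases eq_or_ne γ 0 with rfl | hγ0
  · rw [iterSucc_zero] at hlow
    exact of_forall_lt_of_isRegular hD hμ0 hμ'.1 hν hlow
  obtain ⟨ε, η, hε, hεη⟩ := exists_eq_add_omega0_opow hγ0
  refine hstep ε hε fun θ hθ => ?_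
  rcases eq_zero_or_pos η with rfl | hη0
  · rw [opow_zero] at hεη
    exact hεη ▸ hlow θ hθ
  have hηγ : ω ^ η ≤ γ := hεη ▸ le_add_self
  have hηα : η < α := (opow_lt_opow_iff_right one_lt_omega0).1 (hηγ.trans_lt hγα)
  obtain ⟨s, hs, hlub, hord⟩ := hμ'.2 η hη0 hηα
  -- Induction at `ρ < ω ^ η` will apply to `s n`, of order `≥ η`, with `ν^{+(ε+1)}` as the new
  -- base.
  obtain ⟨_, ⟨n, rfl⟩, hn⟩ := (lt_isLUB_iff hlub).1 (max_lt hθ hlt)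
  have hsn : s n < μ := (hs n.lt_succ_self).trans_le (hlub.1 ⟨_, rfl⟩)
  obtain ⟨f, hf, hA⟩ := hlow (s n) hsn
  choose δ hδγ hδ using fun i => exists_le_iterSucc_of_lt hγ0 (hf i)
  obtain ⟨t, ht⟩ := hγ γ.ToType (by simp) fun i => ToType.mk ⟨δ i, hδγ i⟩
  obtain ⟨d, rfl⟩ := ToType.mk.surjective t
  have hdγ : d.1 < ε + ω ^ η := hεη.symm ▸ d.2
  obtain ⟨ρ, hρ, hdρ⟩ := (Ordinal.lt_add_iff (opow_pos _ omega0_pos).ne').1 hdγ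
  have hreg : IsRegularUltrafilter D (Order.succ (iterSucc ν d)) (s n) := by
    refine of_eventually f (aleph0_pos.trans_le ((hν' d).trans (Order.le_succ _))) ?_ hA (by simp)
    filter_upwards [ht] with i hi
    have : δ i = d := by simpa [Subtype.ext_iff] using hi
    exact Order.lt_succ_iff.2 (this ▸ hδ i)
  have hlt' : ε + 1 + ρ < γ := by
    rw [← hεη, add_assoc]
    gcongr
    exact isPrincipal_add_omega0_opow η (one_lt_opow.2 ⟨one_lt_omega0, hη0.ne'⟩) hρ
  have hργ : ρ < γ := hρ.trans_le hηγ
  refine (IH ρ hργ (hγ.mono (card_le_card hργ.le)) ?_ hρ (hord n) ?_ ?_).mono le_rfl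
    ((le_max_left θ _).trans hn.le)
  · rw [iterSucc_add_one]
    exact isRegular_succ (hν' ε)
  · rw [← iterSucc_add]
    exact (iterSucc_strictMono ν hlt').trans ((le_max_right θ _).trans_lt hn)
  · rw [← iterSucc_add]
    refine hreg.mono (Order.succ_le_succ ((iterSucc_strictMono ν).monotone (hdρ.trans ?_))) le_rfl
    gcongr
    exact le_self_add

end IsRegularUltrafilter

theorem proposition8p2 {I : Type u} (D : Ultrafilter I)
    (κ μ ν : Cardinal.{u}) (α γ : Ordinal.{u})
    (hκ : ℵ₀ ≤ κ) (hμ : ℵ₀ ≤ μ)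
    -- (a) `α > 0` and `α ≤` the first weakly inaccessible cardinal, if there is one
    (hα : 0 < α)
    (hα_le : ∀ θ : Cardinal.{u}, IsWeaklyInaccessible θ → α ≤ θ.ord)
    -- (b) `μ` has cofinality `ω` and order `≥ α`
    (hcof : μ.ord.cof = ℵ₀) (horder : OrderGE α μ)
    -- (c) `κ < μ` and `κ = ν^{+γ}` with `γ < ω ^ α` and `ν` regular
    (hκμ : κ < μ) (hν : ν.IsRegular) (hγ : γ < ω ^ α) (hκν : κ = iterSucc ν γ)
    (hD : IsRegularUltrafilter D (Order.succ κ) μ) :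
    IsRegularUltrafilter D κ μ ∧
      (IsRegularUltrafilter D ℵ₀ ℵ₀ ∨ IsRegularUltrafilter D ν μ) := by
  by_cases h0 : IsRegularUltrafilter D ℵ₀ ℵ₀
  · exact ⟨.of_forall_lt_of_aleph0 h0 hκ hcof fun θ hθ => hD.of_succ_of_lt (hκ.trans_lt hκμ) hθ,
      .inl h0⟩
  · subst hκν
    have hconst := isConstantOn_of_lt_weaklyInaccessible h0 γ.card fun χ hχ =>
      card_lt_of_lt_omega0_opow hχ.aleph0_lt (hα_le χ hχ) hγ
    have h := hD.of_succ_iterSucc h0 γ hconst hν hγ horder hκμ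
    exact ⟨h.mono (le_iterSucc ν γ) le_rfl, .inr h⟩
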